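/- Let $\mathcal M=\{(\alpha,\beta):(\alpha-1)^2+(\alpha-1)(\beta-1)+(\beta-1)^2-3(\alpha+\beta-2)\le 0\}\cup[0,3]^2$. \emph{One-dimensional interpolation.} Let $a\in\mathbb R$, $h>0$, $x_i=a+ih$ ($i\in\mathbb Z$), and let $(\phi_i)_{i\in\mathbb Z}$ be real data. Put $\Delta_i=(\phi_{i+1}-\phi_i)/h$ and $d_i=(\phi_{i-2}-8\phi_{i-1}+8\phi_{i+1}-\phi_{i+2})/(12h)$. For each $i$ let $\alpha=d_i/\Delta_i$, $\beta=d_{i+1}/\Delta_i$ if $\Delta_i\ne0$, and $\alpha=\beta=1$ if $\Delta_i=0$. Replace $\alpha,\beta$ by $\max\{\alpha,0\},\max\{\beta,0\}$. If then $(\alpha,\beta)\notin\mathcal M$, modify the pair as follows: if $\alpha\ge3$ and $\beta\ge3$, set $\alpha=\beta=3$; else if $\beta>3$ and $\alpha+\beta\ge4$, decrease $\beta$ until $(\alpha,\beta)\in\partial\mathcal M$; else if $\beta>3$ and $\alpha+\beta<4$, increase $\alpha$ until $(\alpha,\beta)\in\partial\mathcal M$ or $\alpha=4-\beta$, and in the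 last case subsequently decrease $\beta$ until $(\alpha,\beta)\in\partial\mathcal M$; else (so $\alpha>3$) do the same with the roles of $\alpha$ and $\beta$ exchanged. On $[x_i,x_{i+1}]$ the interpolant $\mathcal I\phi$ is the cubic polynomial with values $\phi_i,\phi_{i+1}$ and derivatives $\alpha\Delta_i,\beta\Delta_i$ at $x_i,x_{i+1}$. \emph{Tensor product.} For $N\in\mathbb N$, origin $a\in\mathbb R^N$ and step sizes $h_1,\dots,h_N>0$, consider the grid of nodes $x_j=(a_k+j_kh_k)_{k}$, $j\in\mathbb Z^N$. For $\phi:\mathbb R^N\to\mathbb R$ let $\mathcal I\phi$ be obtained by applying the above one-dimensional interpolation in the $N$ coordinate directions one after the other, in any fixed order. Then the following hold. (i) (Monotonicity) For $N=1$ and arbitrary data, $\mathcal I\phi$ is nondecreasing on $[x_i,x_{i+1}]$ if $\phi_i\le\phi_{i+1}$, and nonincreasing there if $\phi_i\ge\phi_{i+1}$. (ii) (Positivity, (I2)) For every $N$, every such grid, every order of the directions and every $\phi:\mathbb R^N\to\mathbb R$ there are functions $w_j:\mathbb R^N\to\mathbb R$, $j\in\mathbb Z^N$ (which may depend on $\phi$,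 as $\mathcal I$ is nonlinear), such that $$(\mathcal I\phi)(x)=\sum_j\phi(x_j)\,w_j(x),\qquad w_j\ge0,\qquad w_i(x_j)=\delta_{ij},\qquad \sum_jw_j\equiv1,$$ and $w_j(x)\neq0$ only if $|x_k-(x_j)_k|<h_k$ for all $k$. (iii) (Fourth order accuracy, (I1) with $r=4$) For every $N$ there is a constant $K\ge0$, depending only on $N$, such that for every such grid, every order of the directions, every $\Delta x>0$ with $\max_kh_k\le\Delta x$, and every $\phi\in C^\infty(\mathbb R^N)$ that is strictly monotone between grid points, $$\sup_{\mathbb R^N}|\mathcal I\phi-\phi|\le K\,\Delta x^p\,\sup_{\mathbb R^N}|D^p\phi|\qquad\text{for all integers }0\le p\le4 .$$ (The bound is void if the right-hand supremum is infinite.) Here \emph{strictly monotone between grid points} means that for each $k$, each $i\in\mathbb Z$ and each line parallel to the $k$-th axis, $\phi$ is strictly increasing or strictly decreasing along the part of that line where the $k$-th coordinate lies in $[a_k+ih_k,\,a_k+(i+1)h_k]$. -/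

import Mathlib

/-! Monotone cubic Hermite interpolation (simplified Eisenstat–Jackson–Lewis algorithm) on uniform
tensor product grids. -/

noncomputable section

namespace MonoCubic

/-- The Fritsch–Carlson region `M = M_e ∪ M_b` of admissible pairs `(α, β)`. -/
def region : Set (ℝ × ℝ) :=
  {q | (q.1 - 1) ^ 2 + (q.1 - 1) * (q.2 - 1) + (q.2 - 1) ^ 2 - 3 * (q.1 + q.2 - 2) ≤ 0} ∪
  {q | 0 ≤ q.1 ∧ q.1 ≤ 3 ∧ 0 ≤ q.2 ∧ q.2 ≤ 3}

/-- Decrease the second entry of `(α, β)` until the pair lies in `M`, i.e. return the largest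
`b ≤ β` with `(α, b) ∈ M`. As `M` is closed, the pair reached lies on the boundary of `M` if it
did not lie in `M` from the start. -/
def lower (α β : ℝ) : ℝ := sSup {b | b ≤ β ∧ (α, b) ∈ region}

/-- Increase the first entry of `(α, β)` until the pair lies in `M`, i.e. return the smallest
`a ≥ α` with `(a, β) ∈ M`. -/
def raise (α β : ℝ) : ℝ := sInf {a | α ≤ a ∧ (a, β) ∈ region}

/-- The modification of `(α, β)` when `β > 3`, `α < 3`. If `α + β ≥ 4`, decrease `β` until `M` is
reached. Otherwise increase `α` until `M` is reached or `α = 4 - β`, and in the last case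
subsequently decrease `β` until `M` is reached (in the first case `lower` changes nothing). -/
def modifyBig (α β : ℝ) : ℝ × ℝ :=
  if 4 ≤ α + β then (α, lower α β)
  else (min (raise α β) (4 - β), lower (min (raise α β) (4 - β)) β)

open Classical in
/-- Step 4 of the algorithm. The case of a large `α` is the mirror image of that of a large `β`
(the region `M` is symmetric). -/
def modify (α β : ℝ) : ℝ × ℝ :=
  if (α, β) ∈ region then (α, β)
  else if 3 ≤ α ∧ 3 ≤ β then (3, 3)
  else if 3 < β then modifyBig α β
  else if 3 < α then (modifyBig β α).swap
  else (α, β)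

/-- The divided difference `Δ_i`. -/
def slope (h : ℝ) (f : ℤ → ℝ) (i : ℤ) : ℝ := (f (i + 1) - f i) / h

/-- The symmetric fourth order approximation `d_i` of the derivative at the `i`-th node. -/
def deriv4 (h : ℝ) (f : ℤ → ℝ) (i : ℤ) : ℝ :=
  (f (i - 2) - 8 * f (i - 1) + 8 * f (i + 1) - f (i + 2)) / (12 * h)

open Classical in
/-- Steps 2 to 4: the final pair `(α_i, β_i)` on the `i`-th cell. -/
def ratios (h : ℝ) (f : ℤ → ℝ) (i : ℤ) : ℝ × ℝ :=
  if slope h f i = 0 then modify 1 1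
  else modify (max (deriv4 h f i / slope h f i) 0) (max (deriv4 h f (i + 1) / slope h f i) 0)

/-- The cubic Hermite polynomial on a cell of length `h`, in the variable `s = x - x_i`, with left
value `v`, divided difference `Δ`, and end point derivatives `d₀`, `d₁`. -/
def hermite (h v Δ d₀ d₁ s : ℝ) : ℝ :=
  v + d₀ * s + (3 * Δ - d₁ - 2 * d₀) / h * s ^ 2 + -(2 * Δ - d₁ - d₀) / h ^ 2 * s ^ 3

/-- The polynomial used on the cell `[x_i, x_{i+1}]`, `x_i = a + i h`: the cubic Hermite polynomial
with derivatives `α_i Δ_i` and `β_i Δ_i` at the end points. -/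
def cellPoly (a h : ℝ) (f : ℤ → ℝ) (i : ℤ) (x : ℝ) : ℝ :=
  hermite h (f i) (slope h f i) ((ratios h f i).1 * slope h f i) ((ratios h f i).2 * slope h f i)
    (x - (a + i * h))

/-- One-dimensional interpolation of the data `f` on the grid `x_i = a + i h`, `i ∈ ℤ`. -/
def interp1 (a h : ℝ) (f : ℤ → ℝ) (x : ℝ) : ℝ := cellPoly a h f ⌊(x - a) / h⌋ x

variable {N : ℕ}

/-- The point `x` with its `k`-th coordinate replaced by `t`. -/
def setCoord (x : EuclideanSpace ℝ (Fin N)) (k : Fin N) (t : ℝ) : EuclideanSpace ℝ (Fin N) :=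
  WithLp.toLp 2 (Function.update x.ofLp k t)

/-- The nodes `x_j = (a_k + j_k h_k)_k`, `j ∈ ℤ^N`, of the tensor product grid. -/
def node (a h : Fin N → ℝ) (j : Fin N → ℤ) : EuclideanSpace ℝ (Fin N) :=
  WithLp.toLp 2 (fun k => a k + j k * h k)

/-- Interpolation of a function of `N` variables in its `k`-th variable only. -/
def interpDir (a h : Fin N → ℝ) (k : Fin N) (φ : EuclideanSpace ℝ (Fin N) → ℝ)
    (x : EuclideanSpace ℝ (Fin N)) : ℝ :=
  interp1 (a k) (h k) (fun i => φ (setCoord x k (a k + i * h k))) (x k)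

/-- Tensor product interpolation, dimension by dimension, in the order `σ 0, σ 1, …, σ (N - 1)` from
the outermost one-dimensional operator to the innermost one. -/
def interp (a h : Fin N → ℝ) (σ : Equiv.Perm (Fin N)) (φ : EuclideanSpace ℝ (Fin N) → ℝ) :
    EuclideanSpace ℝ (Fin N) → ℝ :=
  (List.ofFn σ).foldr (interpDir a h) φ

/-- `φ` is strictly monotone between grid points: in each coordinate direction and on each line
segment between two consecutive grid hyperplanes it is strictly increasing or strictly decreasing. -/
def StrictlyMonotoneBetweenNodes (a h : Fin N → ℝ) (φ : EuclideanSpace ℝ (Fin N) → ℝ) : Prop :=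
  ∀ (k : Fin N) (i : ℤ) (x : EuclideanSpace ℝ (Fin N)),
    StrictMonoOn (fun t => φ (setCoord x k t)) (Set.Icc (a k + i * h k) (a k + (i + 1) * h k)) ∨
    StrictAntiOn (fun t => φ (setCoord x k t)) (Set.Icc (a k + i * h k) (a k + (i + 1) * h k))

end MonoCubic

end

/-! On a cell the interpolant is the left value plus the increment times a transition profile from 0
to 1. The derivative of the profile is a quadratic form in `(1 - t, t)`, and `ellipse` is a quarter
of its discriminant, so pairs in `region` give monotone profiles (`hermiteDeriv_nonneg`). As
`modify` always lands in `region`, the data may be arbitrary: this gives (i). It also makes every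
one-dimensional step a convex combination of two neighbouring values, and iteration puts the
interpolant in the convex hull of the surrounding nodal values, hence (ii).

Accuracy rests on stability of the limiter (`limited_dist`): if the unlimited Hermite cubic has
derivative at least `-e`, limiting moves its end slopes by `O(e)`. On each cell the function is
monotone and close to a cubic, together with its derivative when `p ≥ 1`. The slope formula is exact
on cubics, so the unlimited interpolant is almost monotone and limiting costs no order
(`abs_interp_sub_cubic_le`, `exists_cubic_approx`). The estimate tolerates perturbed samples, so
only `φ` itself, not the intermediate interpolants, has to be smooth and monotone when the
directions are iterated. -/

namespace MonoCubic

/-! ### The admissible region and the modification of a pair. -/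

/-- The quadratic form of the ellipse bounding the Fritsch–Carlson region, in expanded form. -/
def ellipse (α β : ℝ) : ℝ := (α + β - 3) ^ 2 - α * β

theorem mem_region_iff {α β : ℝ} :
    (α, β) ∈ region ↔ ellipse α β ≤ 0 ∨ (0 ≤ α ∧ α ≤ 3 ∧ 0 ≤ β ∧ β ≤ 3) := by
  have h : (α - 1) ^ 2 + (α - 1) * (β - 1) + (β - 1) ^ 2 - 3 * (α + β - 2) = ellipse α β := by
    unfold ellipse; ring
  simp only [region, Set.mem_union, Set.mem_ofPred_eq, h]

theorem mem_region_swap {α β : ℝ} : (α, β) ∈ region ↔ (β, α) ∈ region := by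
  have h : ellipse α β = ellipse β α := by unfold ellipse; ring
  rw [mem_region_iff, mem_region_iff, h]
  tauto

theorem isClosed_region : IsClosed region := by
  apply IsClosed.union
  · exact isClosed_le (by fun_prop) (by fun_prop)
  · simp only [Set.ofPred_and]
    exact (isClosed_le (by fun_prop) (by fun_prop)).inter
      ((isClosed_le (by fun_prop) (by fun_prop)).inter
        ((isClosed_le (by fun_prop) (by fun_prop)).inter
          (isClosed_le (by fun_prop) (by fun_prop))))

theorem fst_mem_of_mem_region {α β : ℝ} (h : (α, β) ∈ region) : 0 ≤ α ∧ α ≤ 4 := by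
  rcases mem_region_iff.1 h with h | h
  · unfold ellipse at h
    -- Completing the square in `β`: `4 * ellipse α β = (2β + α - 6)² - 3α(4 - α)`.
    have h' : 0 ≤ α * (4 - α) := by nlinarith [sq_nonneg (2 * β + α - 6)]
    constructor <;> nlinarith
  · exact ⟨h.1, by linarith⟩

theorem snd_mem_of_mem_region {α β : ℝ} (h : (α, β) ∈ region) : 0 ≤ β ∧ β ≤ 4 :=
  fst_mem_of_mem_region (mem_region_swap.1 h)

theorem isClosed_lowerSet (α β : ℝ) : IsClosed {b | b ≤ β ∧ (α, b) ∈ region} :=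
  (isClosed_le continuous_id continuous_const).inter
    (isClosed_region.preimage (by fun_prop : Continuous fun b : ℝ => (α, b)))

theorem isClosed_raiseSet (α β : ℝ) : IsClosed {a | α ≤ a ∧ (a, β) ∈ region} :=
  (isClosed_le continuous_const continuous_id).inter
    (isClosed_region.preimage (by fun_prop : Continuous fun a : ℝ => (a, β)))

theorem le_lower {α β b : ℝ} (hb : b ≤ β) (h : (α, b) ∈ region) : b ≤ lower α β :=
  le_csSup ⟨β, fun _ hx => hx.1⟩ ⟨hb, h⟩

theorem lower_mem {α β b : ℝ} (hb : b ≤ β) (h : (α, b) ∈ region) :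
    lower α β ≤ β ∧ (α, lower α β) ∈ region :=
  (isClosed_lowerSet α β).csSup_mem ⟨b, hb, h⟩ ⟨β, fun _ hx => hx.1⟩

theorem lower_mem_of_le_three {α β : ℝ} (h₀ : 0 ≤ α) (h₃ : α ≤ 3) (hβ : 3 ≤ β) :
    3 ≤ lower α β ∧ lower α β ≤ β ∧ (α, lower α β) ∈ region := by
  have h : (α, (3 : ℝ)) ∈ region := mem_region_iff.2 (Or.inr ⟨h₀, h₃, by norm_num, le_rfl⟩)
  exact ⟨le_lower hβ h, lower_mem hβ h⟩

theorem raise_le {α β a : ℝ} (ha : α ≤ a) (h : (a, β) ∈ region) : raise α β ≤ a :=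
  csInf_le ⟨α, fun _ hx => hx.1⟩ ⟨ha, h⟩

theorem raise_mem {α β a : ℝ} (ha : α ≤ a) (h : (a, β) ∈ region) :
    α ≤ raise α β ∧ (raise α β, β) ∈ region :=
  (isClosed_raiseSet α β).csInf_mem ⟨a, ha, h⟩ ⟨α, fun _ hx => hx.1⟩

/-- When `3 < β` and `α + β < 4`, the point reached by `raise` exists and lies in `[α, 1]`. -/
theorem raise_mem_of_add_lt {α β : ℝ} (hβ : 3 < β) (h₀ : 0 ≤ α) (h : α + β < 4) :
    α ≤ raise α β ∧ raise α β ≤ 1 ∧ (raise α β, β) ∈ region := by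
  have h1 : ((1 : ℝ), β) ∈ region := by
    refine mem_region_iff.2 (Or.inl ?_)
    unfold ellipse
    nlinarith
  have hα : α ≤ 1 := by linarith
  exact ⟨(raise_mem hα h1).1, raise_le hα h1, (raise_mem hα h1).2⟩

theorem modifyBig_mem {α β : ℝ} (h₀ : 0 ≤ α) (h₃ : α ≤ 3) (hβ : 3 < β) :
    modifyBig α β ∈ region := by
  unfold modifyBig
  split_ifs with h
  · exact (lower_mem_of_le_three h₀ h₃ hβ.le).2.2
  · push Not at h
    obtain ⟨r1, r2, -⟩ := raise_mem_of_add_lt hβ h₀ h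
    refine (lower_mem_of_le_three ?_ ?_ hβ.le).2.2
    · exact le_min (h₀.trans r1) (by linarith)
    · exact (min_le_left _ _).trans (by linarith)

theorem modify_mem {α β : ℝ} (hα : 0 ≤ α) (hβ : 0 ≤ β) : modify α β ∈ region := by
  unfold modify
  split_ifs with h1 h2 h3 h4
  · exact h1
  · exact mem_region_iff.2 (Or.inr (by norm_num))
  · refine modifyBig_mem hα ?_ h3
    by_contra hc
    exact h2 ⟨by linarith, h3.le⟩
  · exact mem_region_swap.1 (modifyBig_mem hβ (not_lt.1 h3) h4)
  · exact mem_region_iff.2 (Or.inr ⟨hα, not_lt.1 h4, hβ, not_lt.1 h3⟩)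

/-! ### Monotone cubics and stability of the limiter. -/

/-- The derivative of the cubic Hermite polynomial on the unit interval. -/
def hermiteDeriv (Δ d₀ d₁ t : ℝ) : ℝ :=
  d₀ * (1 - t) ^ 2 + 2 * (3 * Δ - d₀ - d₁) * (t * (1 - t)) + d₁ * t ^ 2

/-- If `α + β ≤ 3`, all three coefficients of the form are nonnegative. Otherwise a point of the
square also lies in the ellipse, and nonpositive discriminant lets one complete the square after
multiplying by `α`. -/
theorem hermiteDeriv_nonneg {α β t : ℝ} (h : (α, β) ∈ region) (ht₀ : 0 ≤ t) (ht₁ : t ≤ 1) :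
    0 ≤ hermiteDeriv 1 α β t := by
  have hα := (fst_mem_of_mem_region h).1
  have hβ := (snd_mem_of_mem_region h).1
  have hs : 0 ≤ 1 - t := by linarith
  unfold hermiteDeriv
  rcases le_total (α + β) 3 with hm | hm
  · have : 0 ≤ 3 * 1 - α - β := by linarith
    positivity
  · have hF : ellipse α β ≤ 0 := by
      rcases mem_region_iff.1 h with h | ⟨-, h1, -, h2⟩
      · exact h
      · unfold ellipse
        nlinarith [mul_nonneg (sub_nonneg.2 h1) (sub_nonneg.2 h2),
          mul_nonneg (sub_nonneg.2 hm) (add_nonneg (sub_nonneg.2 h1) (sub_nonneg.2 h2))]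
    unfold ellipse at hF
    rcases hα.eq_or_lt with rfl | hα
    · have : β = 3 := by nlinarith
      subst this
      nlinarith [sq_nonneg t]
    · refine (mul_nonneg_iff_of_pos_left hα).1 ?_
      nlinarith [sq_nonneg (α * (1 - t) + (3 - α - β) * t),
        mul_nonneg (neg_nonneg.2 hF) (sq_nonneg t)]

/-- The final pair of ratios as a function of the divided difference and the derivative
approximations. -/
noncomputable def limited (Δ d₀ d₁ : ℝ) : ℝ × ℝ :=
  if Δ = 0 then modify 1 1 else modify (max (d₀ / Δ) 0) (max (d₁ / Δ) 0)

theorem ratios_eq_limited (h : ℝ) (f : ℤ → ℝ) (i : ℤ) :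
    ratios h f i = limited (slope h f i) (deriv4 h f i) (deriv4 h f (i + 1)) := by
  unfold ratios limited
  split_ifs <;> rfl

theorem limited_mem (Δ d₀ d₁ : ℝ) : limited Δ d₀ d₁ ∈ region := by
  unfold limited
  split_ifs
  · exact modify_mem zero_le_one zero_le_one
  · exact modify_mem (le_max_right _ _) (le_max_right _ _)

theorem limited_neg (Δ d₀ d₁ : ℝ) : limited (-Δ) (-d₀) (-d₁) = limited Δ d₀ d₁ := by
  unfold limited
  simp only [neg_eq_zero, neg_div_neg_eq]

theorem limited_smul {c : ℝ} (hc : c ≠ 0) (Δ d₀ d₁ : ℝ) :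
    limited (c * Δ) (c * d₀) (c * d₁) = limited Δ d₀ d₁ := by
  unfold limited
  simp only [mul_eq_zero, hc, false_or, mul_div_mul_left _ _ hc]

/-- Quantitative converse of `hermiteDeriv_nonneg`. Adding `η(x + y)²` to the homogenised form makes
it nonnegative on the quadrant. When its cross term is negative, the minimising direction lies in
the quadrant, so the discriminant of the shifted form is nonpositive; expanding gives the bound. -/
theorem ellipse_le {α β η : ℝ} (hη : 0 ≤ η) (hα : 0 ≤ α) (hβ : 0 ≤ β) (hαβ : 3 ≤ α + β)
    (h : ∀ t, 0 ≤ t → t ≤ 1 → -η ≤ hermiteDeriv 1 α β t) :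
    ellipse α β ≤ η * (3 * (α + β) - 6) := by
  have hom : ∀ x y : ℝ, 0 ≤ x → 0 ≤ y → 0 < x + y →
      0 ≤ (α + η) * x ^ 2 + 2 * (3 - α - β + η) * (x * y) + (β + η) * y ^ 2 := by
    intro x y hx hy hxy
    have h1 := h (y / (x + y)) (by positivity) ((div_le_one hxy).2 (by linarith))
    have h2 : 1 - y / (x + y) = x / (x + y) := by field_simp; ring
    unfold hermiteDeriv at h1
    rw [h2] at h1
    have h3 : (α + η) * x ^ 2 + 2 * (3 - α - β + η) * (x * y) + (β + η) * y ^ 2 =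
        (α * (x / (x + y)) ^ 2 + 2 * (3 * 1 - α - β) * (y / (x + y) * (x / (x + y))) +
          β * (y / (x + y)) ^ 2 + η) * (x + y) ^ 2 := by
      field_simp
      ring
    rw [h3]
    have : 0 ≤ α * (x / (x + y)) ^ 2 + 2 * (3 * 1 - α - β) * (y / (x + y) * (x / (x + y))) +
          β * (y / (x + y)) ^ 2 + η := by linarith
    positivity
  unfold ellipse
  rcases le_or_gt (α + β - 3) η with hm | hm
  · nlinarith [mul_nonneg hα hβ, mul_nonneg (sub_nonneg.2 hαβ) (sub_nonneg.2 hm),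
      mul_nonneg hη (sub_nonneg.2 hαβ)]
  · have key : (α + β - 3 - η) ^ 2 ≤ (α + η) * (β + η) := by
      -- The usual test vector has second entry `α + η`; if that vanishes, the mirrored vector is
      -- used.
      rcases (add_nonneg hα hη).eq_or_lt with h0 | h0
      · have hb : 0 < β + η := by linarith
        have h1 := hom (β + η) (α + β - 3 - η) hb.le (by linarith) (by linarith)
        have h2 : 0 ≤ (β + η) * ((α + η) * (β + η) - (α + β - 3 - η) ^ 2) := by nlinarith
        linarith [(mul_nonneg_iff_of_pos_left hb).1 h2]
      · have h1 := hom (α + β - 3 - η) (α + η) (by linarith) h0.le (by linarith)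
        have h2 : 0 ≤ (α + η) * ((α + η) * (β + η) - (α + β - 3 - η) ^ 2) := by nlinarith
        linarith [(mul_nonneg_iff_of_pos_left h0).1 h2]
    nlinarith [mul_nonneg hα hβ, mul_nonneg hη (sub_nonneg.2 hαβ)]

/-- For `β ≥ 3` and `α + β ≥ 4` the ellipse function has `β`-derivative `α + 2β - 6 ≥ 1`. Decreasing
`β` by `δ` thus reaches the ellipse, unless the square is met at height 3 before. -/
theorem sub_le_lower {α β δ : ℝ} (h₀ : 0 ≤ α) (h₃ : α ≤ 3) (hβ : 3 < β) (hαβ : 4 ≤ α + β)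
    (hδ : 0 ≤ δ) (h : ellipse α β ≤ δ) : β - δ ≤ lower α β := by
  rcases le_total (β - δ) 3 with h1 | h1
  · exact h1.trans (lower_mem_of_le_three h₀ h₃ hβ.le).1
  · refine le_lower (by linarith) (mem_region_iff.2 (Or.inl ?_))
    unfold ellipse at *
    nlinarith [mul_nonneg hδ (by linarith : 0 ≤ α + β + (β - δ) - 7)]

/-- The line `α + β = 4` separates the two directions of descent: below it, increasing `α` lowers
`ellipse` at secant rate at least 1, above it decreasing `β` does. Hence each move has length at
most `δ`. -/
theorem modifyBig_dist {α β δ : ℝ} (h₀ : 0 ≤ α) (h₃ : α ≤ 3) (hβ : 3 < β) (hδ : 0 ≤ δ)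
    (h : ellipse α β ≤ δ) :
    |(modifyBig α β).1 - α| ≤ δ ∧ |(modifyBig α β).2 - β| ≤ δ := by
  unfold modifyBig
  split_ifs with h4
  · have h1 := sub_le_lower h₀ h₃ hβ h4 hδ h
    have h2 := (lower_mem_of_le_three h₀ h₃ hβ.le).2.1
    exact ⟨by simpa using hδ, abs_le.2 ⟨by linarith, by linarith⟩⟩
  · push Not at h4
    obtain ⟨r1, r2, r3⟩ := raise_mem_of_add_lt hβ h₀ h4
    have hle : min (raise α β) (4 - β) ≤ α + δ := by
      rcases le_total (4 - β) (α + δ) with h5 | h5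
      · exact (min_le_right _ _).trans h5
      · refine (min_le_left _ _).trans (raise_le (by linarith) (mem_region_iff.2 (Or.inl ?_)))
        unfold ellipse at *
        nlinarith [mul_nonneg hδ (by linarith : 0 ≤ 5 - β - α - (α + δ))]
    have hge : α ≤ min (raise α β) (4 - β) := le_min r1 (by linarith)
    refine ⟨abs_le.2 ⟨by linarith, by linarith⟩, ?_⟩
    rcases le_total (raise α β) (4 - β) with h5 | h5
    · rw [min_eq_left h5]
      have h6 := le_lower le_rfl r3
      have h7 := (lower_mem le_rfl r3).1
      exact abs_le.2 ⟨by linarith, by linarith⟩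
    · rw [min_eq_right h5] at hge ⊢
      -- Moving to the line did not increase `ellipse`, so lowering `β` afterwards still costs at
      -- most `δ`.
      have h6 : ellipse (4 - β) β ≤ δ := by
        unfold ellipse at *
        nlinarith [mul_nonneg (sub_nonneg.2 hge) (by linarith : 0 ≤ 6 - β - α - (4 - β))]
      have h7 := sub_le_lower (by linarith) (by linarith) hβ (by linarith) hδ h6
      have h8 := (lower_mem_of_le_three (h₀.trans hge) (by linarith) hβ.le).2.1
      exact abs_le.2 ⟨by linarith, by linarith⟩

theorem hermiteDeriv_swap (Δ d₀ d₁ t : ℝ) :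
    hermiteDeriv Δ d₁ d₀ t = hermiteDeriv Δ d₀ d₁ (1 - t) := by
  unfold hermiteDeriv; ring

theorem left_le_of_hermiteDeriv {Δ d₀ d₁ e : ℝ}
    (h : ∀ t, 0 ≤ t → t ≤ 1 → -e ≤ hermiteDeriv Δ d₀ d₁ t) : -e ≤ d₀ ∧ d₀ ≤ 4 * Δ + 3 * e := by
  have h0 := h 0 le_rfl zero_le_one
  -- At `t = 2/3` the coefficient of `d₁` vanishes.
  have h1 := h (2 / 3) (by norm_num) (by norm_num)
  unfold hermiteDeriv at h0 h1
  constructor <;> linarith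

theorem right_le_of_hermiteDeriv {Δ d₀ d₁ e : ℝ}
    (h : ∀ t, 0 ≤ t → t ≤ 1 → -e ≤ hermiteDeriv Δ d₀ d₁ t) : -e ≤ d₁ ∧ d₁ ≤ 4 * Δ + 3 * e :=
  left_le_of_hermiteDeriv (d₁ := d₀) fun t h0 h1 => by
    rw [hermiteDeriv_swap]
    exact h _ (by linarith) (by linarith)

/-- A pair close to the region of monotone cubics is moved by `modify` by a small amount only. -/
theorem modify_dist {α β η : ℝ} (hα : 0 ≤ α) (hβ : 0 ≤ β) (hη : 0 ≤ η) (hη₁ : η ≤ 1)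
    (h : ∀ t, 0 ≤ t → t ≤ 1 → -η ≤ hermiteDeriv 1 α β t) :
    |(modify α β).1 - α| ≤ 36 * η ∧ |(modify α β).2 - β| ≤ 36 * η := by
  have hα' := (left_le_of_hermiteDeriv h).2
  have hβ' := (right_le_of_hermiteDeriv h).2
  -- Both entries are at most `4 + 3η ≤ 7`, so `3(α + β) - 6 ≤ 36`.
  have hF : 3 ≤ α + β → ellipse α β ≤ 36 * η := fun h3 => by
    nlinarith [ellipse_le hη hα hβ h3 h,
      mul_nonneg hη (by linarith : 0 ≤ 36 - (3 * (α + β) - 6))]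
  have h36 : 0 ≤ 36 * η := by linarith
  unfold modify
  split_ifs with h1 h2 h3 h4
  · simpa using h36
  · have h5 := h (1 / 2) (by norm_num) (by norm_num)
    unfold hermiteDeriv at h5
    constructor <;> rw [abs_le] <;> constructor <;> linarith [h2.1, h2.2]
  · refine modifyBig_dist hα ?_ h3 h36 (hF (by linarith))
    by_contra hc
    exact h2 ⟨by linarith, h3.le⟩
  · have h5 : ellipse β α = ellipse α β := by unfold ellipse; ring
    exact (modifyBig_dist hβ (not_lt.1 h3) h4 h36 (h5 ▸ hF (by linarith))).symm
  · simpa using h36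

/-- For `Δ ≤ 2e` all quantities are `O(e)`, since ratios in the region lie in `[0, 4]`. For larger
`Δ`, divide by it: truncation at 0 moves a ratio by at most `η = e/Δ` and leaves the derivative
above `-2η`, so `modify_dist` gives `η + 36 * 2η = 73η`. -/
theorem limited_dist {Δ d₀ d₁ e : ℝ} (he : 0 ≤ e)
    (h : ∀ t, 0 ≤ t → t ≤ 1 → -e ≤ hermiteDeriv Δ d₀ d₁ t) :
    |(limited Δ d₀ d₁).1 * Δ - d₀| ≤ 73 * e ∧ |(limited Δ d₀ d₁).2 * Δ - d₁| ≤ 73 * e := by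
  obtain ⟨a1, a2⟩ := left_le_of_hermiteDeriv h
  obtain ⟨b1, b2⟩ := right_le_of_hermiteDeriv h
  rcases le_or_gt Δ (2 * e) with hΔ | hΔ
  · generalize hl : limited Δ d₀ d₁ = l
    have hmem : (l.1, l.2) ∈ region := hl ▸ limited_mem Δ d₀ d₁
    obtain ⟨l1, l2⟩ := fst_mem_of_mem_region hmem
    obtain ⟨r1, r2⟩ := snd_mem_of_mem_region hmem
    constructor <;> rw [abs_le] <;> constructor <;> nlinarith
  · have hpos : 0 < Δ := by linarith
    unfold limited
    rw [if_neg hpos.ne']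
    set η := e / Δ with hη
    have hη0 : 0 ≤ η := by positivity
    have heη : e = η * Δ := by rw [hη]; field_simp
    have hη1 : 2 * η ≤ 1 := by
      rw [hη, ← mul_div_assoc, div_le_one hpos]; exact hΔ.le
    have hα1 : -η ≤ d₀ / Δ := by rw [hη, ← neg_div]; gcongr
    have hβ1 : -η ≤ d₁ / Δ := by rw [hη, ← neg_div]; gcongr
    have dα : d₀ = d₀ / Δ * Δ := by field_simp
    have dβ : d₁ = d₁ / Δ * Δ := by field_simp
    set α := d₀ / Δ with hα
    set β := d₁ / Δ with hβ
    have mα0 : 0 ≤ max α 0 - α := by linarith [le_max_left α 0]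
    have mα1 : max α 0 - α ≤ η := by
      rcases max_cases α 0 with ⟨h1, -⟩ | ⟨h1, -⟩ <;> linarith
    have mβ0 : 0 ≤ max β 0 - β := by linarith [le_max_left β 0]
    have mβ1 : max β 0 - β ≤ η := by
      rcases max_cases β 0 with ⟨h1, -⟩ | ⟨h1, -⟩ <;> linarith
    have hq : ∀ t, 0 ≤ t → t ≤ 1 → -(2 * η) ≤ hermiteDeriv 1 (max α 0) (max β 0) t := by
      intro t ht0 ht1
      have h1 := h t ht0 ht1
      have h2 : hermiteDeriv Δ d₀ d₁ t = hermiteDeriv 1 α β t * Δ := by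
        unfold hermiteDeriv
        linear_combination ((1 - t) * (1 - 3 * t)) * dα + (t * (3 * t - 2)) * dβ
      rw [h2, heη, ← neg_mul] at h1
      have h3 := le_of_mul_le_mul_right h1 hpos
      have h4 : hermiteDeriv 1 (max α 0) (max β 0) t = hermiteDeriv 1 α β t
          + (max α 0 - α) * ((1 - t) * (1 - 3 * t)) + (max β 0 - β) * (t * (3 * t - 2)) := by
        unfold hermiteDeriv; ring
      have h5 : -(1 / 3) ≤ (1 - t) * (1 - 3 * t) := by nlinarith [sq_nonneg (3 * t - 2)]
      have h6 : -(1 / 3) ≤ t * (3 * t - 2) := by nlinarith [sq_nonneg (3 * t - 1)]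
      rw [h4]
      nlinarith [mul_le_mul_of_nonneg_left h5 mα0, mul_le_mul_of_nonneg_left h6 mβ0]
    obtain ⟨m1, m2⟩ := modify_dist (le_max_right α 0) (le_max_right β 0)
      (by linarith : 0 ≤ 2 * η) hη1 hq
    have fin : ∀ u v w : ℝ, |w - v| ≤ 36 * (2 * η) → 0 ≤ v - u → v - u ≤ η →
        |w * Δ - u * Δ| ≤ 73 * (η * Δ) := by
      intro u v w h1 h2 h3
      rw [← sub_mul, abs_mul, abs_of_pos hpos, ← mul_assoc]
      refine mul_le_mul_of_nonneg_right ?_ hpos.le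
      rw [abs_le] at *
      constructor <;> linarith
    have c1 := fin α _ _ m1 mα0 mα1
    have c2 := fin β _ _ m2 mβ0 mβ1
    rw [← dα, ← heη] at c1
    rw [← dβ, ← heη] at c2
    exact ⟨c1, c2⟩

/-! ### Transition profiles and monotonicity of the interpolant. -/

theorem hasDerivAt_hermite (v Δ d₀ d₁ t : ℝ) :
    HasDerivAt (hermite 1 v Δ d₀ d₁) (hermiteDeriv Δ d₀ d₁ t) t := by
  have h := ((((hasDerivAt_id t).const_mul d₀).const_add v).add
    ((hasDerivAt_pow 2 t).const_mul ((3 * Δ - d₁ - 2 * d₀) / 1))).add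
    ((hasDerivAt_pow 3 t).const_mul (-(2 * Δ - d₁ - d₀) / 1 ^ 2))
  refine h.congr_deriv ?_
  unfold hermiteDeriv
  push_cast
  ring

/-- The transition profile from `0` to `1` on the unit interval, with end point slopes `q`. -/
noncomputable def profile (q : ℝ × ℝ) (t : ℝ) : ℝ := hermite 1 0 1 q.1 q.2 t

theorem profile_zero (q : ℝ × ℝ) : profile q 0 = 0 := by
  unfold profile hermite; ring

theorem profile_one (q : ℝ × ℝ) : profile q 1 = 1 := by
  unfold profile hermite; ring

theorem monotoneOn_profile {q : ℝ × ℝ} (hq : q ∈ region) :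
    MonotoneOn (profile q) (Set.Icc 0 1) := by
  have hd : ∀ t, HasDerivAt (profile q) (hermiteDeriv 1 q.1 q.2 t) t :=
    fun t => hasDerivAt_hermite 0 1 q.1 q.2 t
  refine monotoneOn_of_deriv_nonneg (convex_Icc 0 1)
    (fun t _ => (hd t).continuousAt.continuousWithinAt)
    (fun t _ => (hd t).differentiableAt.differentiableWithinAt) fun t ht => ?_
  rw [interior_Icc] at ht
  rw [(hd t).deriv]
  exact hermiteDeriv_nonneg (α := q.1) (β := q.2) hq ht.1.le ht.2.le

theorem profile_mem {q : ℝ × ℝ} (hq : q ∈ region) {t : ℝ} (ht : t ∈ Set.Icc (0 : ℝ) 1) :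
    profile q t ∈ Set.Icc (0 : ℝ) 1 := by
  have h := monotoneOn_profile hq
  constructor
  · rw [← profile_zero q]
    exact h ⟨le_rfl, zero_le_one⟩ ht ht.1
  · rw [← profile_one q]
    exact h ht ⟨zero_le_one, le_rfl⟩ ht.2

theorem ratios_mem (h : ℝ) (f : ℤ → ℝ) (i : ℤ) : ratios h f i ∈ region := by
  rw [ratios_eq_limited]
  exact limited_mem _ _ _

theorem cellPoly_eq {h : ℝ} (hh : 0 < h) (a : ℝ) (f : ℤ → ℝ) (i : ℤ) (x : ℝ) :
    cellPoly a h f i x =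
      f i + (f (i + 1) - f i) * profile (ratios h f i) ((x - a) / h - i) := by
  unfold cellPoly profile hermite slope
  field_simp
  ring

theorem interp1_eq {h : ℝ} (hh : 0 < h) (a : ℝ) (f : ℤ → ℝ) (i : ℤ) {x : ℝ}
    (hx : (x - a) / h - i ∈ Set.Icc (0 : ℝ) 1) :
    interp1 a h f x = f i + (f (i + 1) - f i) * profile (ratios h f i) ((x - a) / h - i) := by
  unfold interp1
  -- At the right end point the floor selects the next cell, whose polynomial takes the same nodal
  -- value there.
  rcases hx.2.eq_or_lt with h1 | h1
  · have h2 : (x - a) / h = ((i + 1 : ℤ) : ℝ) := by push_cast; linarith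
    rw [cellPoly_eq hh, h1, profile_one, h2, Int.floor_intCast, sub_self, profile_zero]
    ring
  · have h2 : ⌊(x - a) / h⌋ = i := Int.floor_eq_iff.2 ⟨by linarith [hx.1], by linarith⟩
    rw [h2, cellPoly_eq hh]

theorem mem_unit_of_mem_cell {a h : ℝ} (hh : 0 < h) {i : ℤ} {x : ℝ}
    (hx : x ∈ Set.Icc (a + i * h) (a + (i + 1) * h)) : (x - a) / h - i ∈ Set.Icc (0 : ℝ) 1 := by
  obtain ⟨h1, h2⟩ := hx
  constructor
  · rw [sub_nonneg, le_div_iff₀ hh]; linarith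
  · rw [sub_le_iff_le_add, div_le_iff₀ hh]; linarith

theorem monotoneOn_interp1 {h : ℝ} (hh : 0 < h) (a : ℝ) {f : ℤ → ℝ} {i : ℤ}
    (hf : f i ≤ f (i + 1)) :
    MonotoneOn (interp1 a h f) (Set.Icc (a + i * h) (a + (i + 1) * h)) := by
  intro x hx y hy hxy
  have hx' := mem_unit_of_mem_cell hh hx
  have hy' := mem_unit_of_mem_cell hh hy
  rw [interp1_eq hh a f i hx', interp1_eq hh a f i hy']
  have h1 := monotoneOn_profile (ratios_mem h f i) hx' hy' (by gcongr)
  gcongr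

theorem antitoneOn_interp1 {h : ℝ} (hh : 0 < h) (a : ℝ) {f : ℤ → ℝ} {i : ℤ}
    (hf : f (i + 1) ≤ f i) :
    AntitoneOn (interp1 a h f) (Set.Icc (a + i * h) (a + (i + 1) * h)) := by
  intro x hx y hy hxy
  have hx' := mem_unit_of_mem_cell hh hx
  have hy' := mem_unit_of_mem_cell hh hy
  rw [interp1_eq hh a f i hx', interp1_eq hh a f i hy']
  have h1 := monotoneOn_profile (ratios_mem h f i) hx' hy' (by gcongr)
  nlinarith

/-! ### Error for perturbed samples of an almost monotone cubic. -/

theorem ratios_eq_limited_unit {h : ℝ} (hh : 0 < h) (f : ℤ → ℝ) (i : ℤ) :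
    ratios h f i = limited (f (i + 1) - f i)
      ((f (i - 2) - 8 * f (i - 1) + 8 * f (i + 1) - f (i + 2)) / 12)
      ((f (i - 1) - 8 * f i + 8 * f (i + 2) - f (i + 3)) / 12) := by
  rw [ratios_eq_limited, ← limited_smul hh.ne']
  unfold slope deriv4
  rw [show i + 1 - 2 = i - 1 by ring, show i + 1 - 1 = i by ring,
    show i + 1 + 1 = i + 2 by ring, show i + 1 + 2 = i + 3 by ring]
  congr 1 <;> field_simp

theorem mul_profile (S : ℝ) (q : ℝ × ℝ) (t : ℝ) : S * profile q t =
    S * (t ^ 2 * (3 - 2 * t)) + q.1 * S * (t * (1 - t) ^ 2) - q.2 * S * (t ^ 2 * (1 - t)) := by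
  unfold profile hermite; ring

/-- One-dimensional interpolation of perturbed samples of an almost nondecreasing cubic. -/
theorem abs_interp_sub_cubic_le {h : ℝ} (hh : 0 < h) {f : ℤ → ℝ} {i : ℤ} {c₀ c₁ c₂ c₃ e : ℝ}
    (hf : ∀ j : ℤ, -2 ≤ j → j ≤ 3 →
      |f (i + j) - (c₀ + c₁ * j + c₂ * (j : ℝ) ^ 2 + c₃ * (j : ℝ) ^ 3)| ≤ e)
    (hmono : ∀ t, 0 ≤ t → t ≤ 1 → -e ≤ c₁ + 2 * c₂ * t + 3 * c₃ * t ^ 2)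
    {t : ℝ} (ht : t ∈ Set.Icc (0 : ℝ) 1) :
    |f i + (f (i + 1) - f i) * profile (ratios h f i) t -
      (c₀ + c₁ * t + c₂ * t ^ 2 + c₃ * t ^ 3)| ≤ 1500 * e := by
  have b1 := abs_le.1 (hf (-2) (by norm_num) (by norm_num))
  have b2 := abs_le.1 (hf (-1) (by norm_num) (by norm_num))
  have b3 := abs_le.1 (hf 0 (by norm_num) (by norm_num))
  have b4 := abs_le.1 (hf 1 (by norm_num) (by norm_num))
  have b5 := abs_le.1 (hf 2 (by norm_num) (by norm_num))
  have b6 := abs_le.1 (hf 3 (by norm_num) (by norm_num))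
  rw [ratios_eq_limited_unit hh, mul_profile]
  rw [← sub_eq_add_neg] at b1 b2
  rw [add_zero] at b3
  push_cast at b1 b2 b3 b4 b5 b6
  have he : 0 ≤ e := by linarith [b3.1, b3.2]
  set D₀ := (f (i - 2) - 8 * f (i - 1) + 8 * f (i + 1) - f (i + 2)) / 12 with hD₀
  set D₁ := (f (i - 1) - 8 * f i + 8 * f (i + 2) - f (i + 3)) / 12 with hD₁
  set S := f (i + 1) - f i with hS
  -- The five-point formula is exact on cubics; its absolute weights sum to `18/12 = 3/2`.
  have e0 : |D₀ - c₁| ≤ 3 / 2 * e := by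
    rw [hD₀]; exact abs_le.2 ⟨by linarith, by linarith⟩
  have e1 : |D₁ - (c₁ + 2 * c₂ + 3 * c₃)| ≤ 3 / 2 * e := by
    rw [hD₁]; exact abs_le.2 ⟨by linarith, by linarith⟩
  have eS : |S - (c₁ + c₂ + c₃)| ≤ 2 * e := by
    rw [hS]; exact abs_le.2 ⟨by linarith, by linarith⟩
  have e3 : |f i - c₀| ≤ e := abs_le.2 ⟨by linarith, by linarith⟩
  clear_value D₀ D₁ S
  clear b1 b2 b3 b4 b5 b6 hf hD₀ hD₁ hS
  have hmul : ∀ x y c : ℝ, |x| ≤ c → |y| ≤ 1 → |x * y| ≤ c := fun x y c h1 h2 => by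
    rw [abs_mul]
    nlinarith [abs_nonneg x, abs_nonneg y]
  have hq : ∀ t, 0 ≤ t → t ≤ 1 → -(10 * e) ≤ hermiteDeriv S D₀ D₁ t := by
    intro t h0 h1
    have h2 : hermiteDeriv S D₀ D₁ t = (c₁ + 2 * c₂ * t + 3 * c₃ * t ^ 2) +
        (D₀ - c₁) * ((1 - t) * (1 - 3 * t)) + 6 * ((S - (c₁ + c₂ + c₃)) * (t * (1 - t))) +
        (D₁ - (c₁ + 2 * c₂ + 3 * c₃)) * (t * (3 * t - 2)) := by
      unfold hermiteDeriv; ring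
    have m0 := abs_le.1 (hmul _ ((1 - t) * (1 - 3 * t)) _ e0
      (abs_le.2 ⟨by nlinarith [sq_nonneg (3 * t - 2)], by nlinarith⟩))
    have m1 := abs_le.1 (hmul _ (t * (3 * t - 2)) _ e1
      (abs_le.2 ⟨by nlinarith [sq_nonneg (3 * t - 1)], by nlinarith⟩))
    have m2 : |(S - (c₁ + c₂ + c₃)) * (t * (1 - t))| ≤ 2 * e * (1 / 4) := by
      rw [abs_mul]
      refine mul_le_mul eS (abs_le.2 ⟨by nlinarith, by nlinarith [sq_nonneg (2 * t - 1)]⟩)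
        (abs_nonneg _) (by linarith)
    have m2' := abs_le.1 m2
    rw [h2]
    linarith [hmono t h0 h1]
  obtain ⟨l0, l1⟩ := limited_dist (by linarith : 0 ≤ 10 * e) hq
  generalize limited S D₀ D₁ = q at l0 l1 ⊢
  obtain ⟨t0, t1⟩ := ht
  have s0 : 0 ≤ 1 - t := by linarith
  -- `73 * 10` from limiting plus `3/2` from the difference formula, rounded up.
  have k0 : |q.1 * S - c₁| ≤ 740 * e := by
    rw [abs_le] at *
    constructor <;> linarith
  have k1 : |q.2 * S - (c₁ + 2 * c₂ + 3 * c₃)| ≤ 740 * e := by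
    rw [abs_le] at *
    constructor <;> linarith
  have n0 := abs_le.1 (hmul _ (t ^ 2 * (3 - 2 * t)) _ eS (abs_le.2
    ⟨by nlinarith [mul_nonneg (sq_nonneg t) (by linarith : 0 ≤ 3 - 2 * t)],
      by nlinarith [mul_nonneg (sq_nonneg (1 - t)) (by linarith : 0 ≤ 1 + 2 * t)]⟩))
  have n1 := abs_le.1 (hmul _ (t * (1 - t) ^ 2) _ k0 (abs_le.2
    ⟨by nlinarith [mul_nonneg t0 (sq_nonneg (1 - t))],
      mul_le_one₀ t1 (sq_nonneg _) (pow_le_one₀ s0 (by linarith))⟩))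
  have n2 := abs_le.1 (hmul _ (t ^ 2 * (1 - t)) _ k1 (abs_le.2
    ⟨by nlinarith [mul_nonneg (sq_nonneg t) s0],
      mul_le_one₀ (pow_le_one₀ t0 t1) s0 (by linarith)⟩))
  have split : f i + (S * (t ^ 2 * (3 - 2 * t)) + q.1 * S * (t * (1 - t) ^ 2) -
      q.2 * S * (t ^ 2 * (1 - t))) - (c₀ + c₁ * t + c₂ * t ^ 2 + c₃ * t ^ 3) =
      (f i - c₀) + (S - (c₁ + c₂ + c₃)) * (t ^ 2 * (3 - 2 * t)) +
      (q.1 * S - c₁) * (t * (1 - t) ^ 2) -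
      (q.2 * S - (c₁ + 2 * c₂ + 3 * c₃)) * (t ^ 2 * (1 - t)) := by ring
  rw [split]
  have e3' := abs_le.1 e3
  exact abs_le.2 ⟨by linarith, by linarith⟩

theorem ratios_neg (h : ℝ) (f : ℤ → ℝ) (i : ℤ) : ratios h (fun j => -f j) i = ratios h f i := by
  rw [ratios_eq_limited, ratios_eq_limited, ← limited_neg]
  congr 1 <;> simp only [slope, deriv4] <;> ring

/-- One-dimensional interpolation of perturbed samples of an almost nonincreasing cubic. -/
theorem abs_interp_sub_cubic_le' {h : ℝ} (hh : 0 < h) {f : ℤ → ℝ} {i : ℤ} {c₀ c₁ c₂ c₃ e : ℝ}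
    (hf : ∀ j : ℤ, -2 ≤ j → j ≤ 3 →
      |f (i + j) - (c₀ + c₁ * j + c₂ * (j : ℝ) ^ 2 + c₃ * (j : ℝ) ^ 3)| ≤ e)
    (hmono : ∀ t, 0 ≤ t → t ≤ 1 → c₁ + 2 * c₂ * t + 3 * c₃ * t ^ 2 ≤ e)
    {t : ℝ} (ht : t ∈ Set.Icc (0 : ℝ) 1) :
    |f i + (f (i + 1) - f i) * profile (ratios h f i) t -
      (c₀ + c₁ * t + c₂ * t ^ 2 + c₃ * t ^ 3)| ≤ 1500 * e := by
  have key := abs_interp_sub_cubic_le hh (f := fun j => -f j) (i := i)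
    (c₀ := -c₀) (c₁ := -c₁) (c₂ := -c₂) (c₃ := -c₃) (e := e)
    (fun j h1 h2 => by rw [← abs_neg]; convert hf j h1 h2 using 2; ring)
    (fun t h1 h2 => by linarith [hmono t h1 h2]) ht
  rw [ratios_neg, ← abs_neg] at key
  convert key using 2
  ring

/-! ### Polynomial approximation of smooth functions. -/

theorem abs_sub_le_of_deriv {f g f' g' : ℝ → ℝ} {M r : ℝ}
    (hf : ∀ t, HasDerivAt f (f' t) t) (hg : ∀ t, HasDerivAt g (g' t) t) (h0 : f 0 = g 0)
    (h : ∀ t ∈ Set.Icc (-r) r, |f' t - g' t| ≤ M) {t : ℝ} (ht : t ∈ Set.Icc (-r) r) :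
    |f t - g t| ≤ r * M := by
  have hr : (0 : ℝ) ∈ Set.Icc (-r) r := ⟨by linarith [ht.1, ht.2], by linarith [ht.1, ht.2]⟩
  have key := (convex_Icc (-r) r).norm_image_sub_le_of_norm_hasDerivWithin_le
    (f := fun t => f t - g t) (f' := fun t => f' t - g' t) (C := M)
    (fun x _ => ((hf x).sub (hg x)).hasDerivWithinAt) h hr ht
  simp only [h0, sub_self, sub_zero, Real.norm_eq_abs] at key
  have hM : 0 ≤ M := (abs_nonneg _).trans (h 0 hr)
  calc |f t - g t| ≤ M * |t| := key
    _ ≤ M * r := by gcongr; exact abs_le.2 ht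
    _ = r * M := mul_comm _ _

/-- Taylor approximation on `[-r, r]` by a polynomial of degree less than `p`. -/
theorem exists_taylor_coeff (r : ℝ) (p : ℕ) : ∀ {u : ℝ → ℝ} {ε : ℝ},
    ContDiff ℝ ((⊤ : ℕ∞) : WithTop ℕ∞) u → (∀ t, |iteratedDeriv p u t| ≤ ε) →
    ∃ c : ℕ → ℝ, ∀ t ∈ Set.Icc (-r) r,
      |u t - ∑ k ∈ Finset.range p, c k * t ^ k| ≤ r ^ p * ε := by
  induction p with
  | zero =>
    intro u ε _ h
    exact ⟨0, fun t _ => by simpa using h t⟩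
  | succ p ih =>
    intro u ε hu h
    have hu' : Differentiable ℝ u ∧ ContDiff ℝ ((⊤ : ℕ∞) : WithTop ℕ∞) (deriv u) :=
      contDiff_infty_iff_deriv.1 hu
    obtain ⟨c, hc⟩ := ih hu'.2 (ε := ε) fun t => by simpa only [iteratedDeriv_succ'] using h t
    refine ⟨fun k => k.casesOn (u 0) fun k => c k / (k + 1), fun t ht => ?_⟩
    rw [pow_succ', mul_assoc]
    refine abs_sub_le_of_deriv
      (g := fun t => ∑ k ∈ Finset.range (p + 1),
        (k.casesOn (u 0) fun k => c k / (k + 1) : ℝ) * t ^ k)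
      (g' := fun t => ∑ k ∈ Finset.range p, c k * t ^ k)
      (fun t => (hu'.1 t).hasDerivAt) (fun t => ?_) ?_ hc ht
    · simp only [Finset.sum_range_succ']
      have h1 : ∀ k ∈ Finset.range p,
          HasDerivAt (fun t : ℝ => c k / (k + 1) * t ^ (k + 1)) (c k * t ^ k) t := by
        intro k _
        refine ((hasDerivAt_pow (k + 1) t).const_mul (c k / (k + 1))).congr_deriv ?_
        push_cast
        field_simp
      simpa using HasDerivAt.fun_sum h1
    · simp [Finset.sum_range_succ']

theorem exists_quadratic_of_sum (c : ℕ → ℝ) {q : ℕ} (hq : q ≤ 3) :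
    ∃ b₀ b₁ b₂ : ℝ, ∀ t, ∑ k ∈ Finset.range q, c k * t ^ k = b₀ + b₁ * t + b₂ * t ^ 2 := by
  interval_cases q
  · exact ⟨0, 0, 0, fun t => by simp⟩
  · exact ⟨c 0, 0, 0, fun t => by simp⟩
  · exact ⟨c 0, c 1, 0, fun t => by simp [Finset.sum_range_succ]⟩
  · exact ⟨c 0, c 1, c 2, fun t => by simp [Finset.sum_range_succ]⟩

theorem deriv_nonneg_of_monotoneOn {u : ℝ → ℝ} (hu : Differentiable ℝ u)
    (hm : MonotoneOn u (Set.Icc 0 1)) {t : ℝ} (ht : t ∈ Set.Icc (0 : ℝ) 1) : 0 ≤ deriv u t := by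
  rw [← (hu t).derivWithin (uniqueDiffOn_Icc zero_lt_one t ht)]
  exact hm.derivWithin_nonneg

theorem deriv_nonpos_of_antitoneOn {u : ℝ → ℝ} (hu : Differentiable ℝ u)
    (hm : AntitoneOn u (Set.Icc 0 1)) {t : ℝ} (ht : t ∈ Set.Icc (0 : ℝ) 1) : deriv u t ≤ 0 := by
  rw [← (hu t).derivWithin (uniqueDiffOn_Icc zero_lt_one t ht)]
  exact hm.derivWithin_nonpos

/-- For `p ≥ 1` the derivative is approximated first and the polynomial then integrated, so one
cubic is close to `u` with derivative close to `u'` and inherits monotonicity up to `O(ε)`. The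
interval `[-3, 3]` covers the stencil `-2, …, 3`; `81 = 3 * 3³`. -/
theorem exists_cubic_approx {u : ℝ → ℝ} (hu : ContDiff ℝ ((⊤ : ℕ∞) : WithTop ℕ∞) u) {p : ℕ}
    (hp : p ≤ 4) {ε : ℝ} (h : ∀ t, |iteratedDeriv p u t| ≤ ε) :
    ∃ c₀ c₁ c₂ c₃ : ℝ,
      (∀ t ∈ Set.Icc (-3 : ℝ) 3, |u t - (c₀ + c₁ * t + c₂ * t ^ 2 + c₃ * t ^ 3)| ≤ 81 * ε) ∧
      (MonotoneOn u (Set.Icc 0 1) →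
        ∀ t, 0 ≤ t → t ≤ 1 → -(81 * ε) ≤ c₁ + 2 * c₂ * t + 3 * c₃ * t ^ 2) ∧
      (AntitoneOn u (Set.Icc 0 1) →
        ∀ t, 0 ≤ t → t ≤ 1 → c₁ + 2 * c₂ * t + 3 * c₃ * t ^ 2 ≤ 81 * ε) := by
  have hε : 0 ≤ ε := (abs_nonneg _).trans (h 0)
  rcases p with _ | q
  · refine ⟨0, 0, 0, 0, fun t _ => ?_, fun _ t _ _ => by linarith, fun _ t _ _ => by linarith⟩
    have := h t
    rw [iteratedDeriv_zero] at this
    simp only [zero_mul, add_zero, sub_zero]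
    linarith
  · have hu' : Differentiable ℝ u ∧ ContDiff ℝ ((⊤ : ℕ∞) : WithTop ℕ∞) (deriv u) :=
      contDiff_infty_iff_deriv.1 hu
    obtain ⟨c, hc⟩ := exists_taylor_coeff 3 q hu'.2 (ε := ε)
      fun t => by simpa only [iteratedDeriv_succ'] using h t
    have hq : q ≤ 3 := by omega
    obtain ⟨b₀, b₁, b₂, hb⟩ := exists_quadratic_of_sum c hq
    have hc' : ∀ t ∈ Set.Icc (-3 : ℝ) 3,
        |deriv u t - (b₀ + b₁ * t + b₂ * t ^ 2)| ≤ 27 * ε := by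
      intro t ht
      rw [← hb]
      refine (hc t ht).trans (mul_le_mul_of_nonneg_right ?_ hε)
      calc (3 : ℝ) ^ q ≤ 3 ^ 3 := pow_le_pow_right₀ (by norm_num) hq
        _ = 27 := by norm_num
    have hsub : ∀ t : ℝ, 0 ≤ t → t ≤ 1 → t ∈ Set.Icc (-3 : ℝ) 3 :=
      fun t h0 h1 => ⟨by linarith, by linarith⟩
    refine ⟨u 0, b₀, b₁ / 2, b₂ / 3, fun t ht => ?_, fun hm t h0 h1 => ?_, fun hm t h0 h1 => ?_⟩
    · rw [show 81 * ε = 3 * (27 * ε) by ring]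
      refine abs_sub_le_of_deriv
        (g := fun t => u 0 + b₀ * t + b₁ / 2 * t ^ 2 + b₂ / 3 * t ^ 3)
        (fun t => (hu'.1 t).hasDerivAt) (fun t => ?_) (by simp) hc' ht
      have h1 := ((((hasDerivAt_id t).const_mul b₀).const_add (u 0)).add
        ((hasDerivAt_pow 2 t).const_mul (b₁ / 2))).add
        ((hasDerivAt_pow 3 t).const_mul (b₂ / 3))
      refine h1.congr_deriv ?_
      push_cast
      ring
    · have h2 := deriv_nonneg_of_monotoneOn hu'.1 hm ⟨h0, h1⟩
      have h3 := (abs_le.1 (hc' t (hsub t h0 h1))).2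
      linarith
    · have h2 := deriv_nonpos_of_antitoneOn hu'.1 hm ⟨h0, h1⟩
      have h3 := (abs_le.1 (hc' t (hsub t h0 h1))).1
      linarith

/-- One-dimensional interpolation of perturbed samples of a smooth function that is monotone on
the cell under consideration. -/
theorem abs_interp_sub_le {h : ℝ} (hh : 0 < h) {u : ℝ → ℝ}
    (hu : ContDiff ℝ ((⊤ : ℕ∞) : WithTop ℕ∞) u)
    (hm : MonotoneOn u (Set.Icc 0 1) ∨ AntitoneOn u (Set.Icc 0 1)) {p : ℕ} (hp : p ≤ 4)
    {ε : ℝ} (hε : ∀ t, |iteratedDeriv p u t| ≤ ε) {f : ℤ → ℝ} {i : ℤ} {E : ℝ}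
    (hf : ∀ j : ℤ, |f (i + j) - u j| ≤ E) {t : ℝ} (ht : t ∈ Set.Icc (0 : ℝ) 1) :
    |f i + (f (i + 1) - f i) * profile (ratios h f i) t - u t| ≤ 121581 * (E + ε) := by
  have hE : 0 ≤ E := (abs_nonneg _).trans (hf 0)
  have hε0 : 0 ≤ ε := (abs_nonneg _).trans (hε 0)
  obtain ⟨c₀, c₁, c₂, c₃, ha, hmon, hant⟩ := exists_cubic_approx hu hp hε
  have hf' : ∀ j : ℤ, -2 ≤ j → j ≤ 3 →
      |f (i + j) - (c₀ + c₁ * j + c₂ * (j : ℝ) ^ 2 + c₃ * (j : ℝ) ^ 3)| ≤ E + 81 * ε := by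
    intro j h1 h2
    have h1' : (-2 : ℝ) ≤ j := by exact_mod_cast h1
    have h2' : (j : ℝ) ≤ 3 := by exact_mod_cast h2
    have h3 := ha j ⟨by linarith, h2'⟩
    exact (abs_sub_le _ (u j) _).trans (add_le_add (hf j) h3)
  have h1 : |f i + (f (i + 1) - f i) * profile (ratios h f i) t -
      (c₀ + c₁ * t + c₂ * t ^ 2 + c₃ * t ^ 3)| ≤ 1500 * (E + 81 * ε) := by
    rcases hm with hm | hm
    · exact abs_interp_sub_cubic_le hh hf' (fun t h0 h1 => by linarith [hmon hm t h0 h1]) ht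
    · exact abs_interp_sub_cubic_le' hh hf' (fun t h0 h1 => by linarith [hant hm t h0 h1]) ht
  have h2 := ha t ⟨by linarith [ht.1], by linarith [ht.2]⟩
  rw [abs_sub_comm] at h2
  have h3 := (abs_sub_le _ _ (u t)).trans (add_le_add h1 h2)
  -- `121581 = 1500 * 81 + 81`.
  linarith

/-- With `v` a grid step this is the source of the factor `Δx ^ p`: each cell is rescaled to unit
length. -/
theorem abs_iteratedDeriv_comp_line_le {F : Type*} [NormedAddCommGroup F] [NormedSpace ℝ F]
    {φ : F → ℝ} (hφ : ContDiff ℝ ((⊤ : ℕ∞) : WithTop ℕ∞) φ) {p : ℕ} {B : ℝ}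
    (hB : ∀ y, ‖iteratedFDeriv ℝ p φ y‖ ≤ B) (y v : F) (t : ℝ) :
    |iteratedDeriv p (fun t : ℝ => φ (y + t • v)) t| ≤ B * ‖v‖ ^ p := by
  have hφ' : ContDiff ℝ p (fun z => φ (y + z)) :=
    (hφ.of_le (by exact_mod_cast le_top)).comp (contDiff_const.add contDiff_id)
  have h1 := (ContinuousLinearMap.toSpanSingleton ℝ v).iteratedFDeriv_comp_right hφ' t
    (i := p) le_rfl
  have h2 : (fun t : ℝ => φ (y + t • v)) =
      (fun z => φ (y + z)) ∘ ContinuousLinearMap.toSpanSingleton ℝ v := by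
    ext t; simp
  rw [← Real.norm_eq_abs, ← norm_iteratedFDeriv_eq_norm_iteratedDeriv, h2, h1]
  refine (ContinuousMultilinearMap.norm_compContinuousLinearMap_le _ _).trans ?_
  rw [iteratedFDeriv_comp_add_left]
  simp only [ContinuousLinearMap.norm_toSpanSingleton, Finset.prod_const, Finset.card_univ,
    Fintype.card_fin]
  gcongr
  exact hB _

/-! ### Accuracy in several variables. -/

variable {N : ℕ}

theorem setCoord_apply (x : EuclideanSpace ℝ (Fin N)) (k l : Fin N) (t : ℝ) :
    setCoord x k t l = if l = k then t else x l := by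
  simp [setCoord, Function.update_apply]

theorem setCoord_self (x : EuclideanSpace ℝ (Fin N)) (k : Fin N) : setCoord x k (x k) = x := by
  ext l
  rw [setCoord_apply]
  split_ifs with h
  · rw [h]
  · rfl

theorem setCoord_add (x : EuclideanSpace ℝ (Fin N)) (k : Fin N) (b c t : ℝ) :
    setCoord x k (b + t * c) = setCoord x k b + t • EuclideanSpace.single k c := by
  ext l
  simp only [PiLp.add_apply, PiLp.smul_apply, setCoord_apply, PiLp.single_apply,
    smul_eq_mul]
  split_ifs <;> simp

theorem fract_mem (y : ℝ) : y - ⌊y⌋ ∈ Set.Icc (0 : ℝ) 1 :=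
  ⟨Int.fract_nonneg y, (Int.fract_lt_one y).le⟩

theorem interpDir_eq {a h : Fin N → ℝ} (hh : ∀ k, 0 < h k) (k : Fin N)
    (φ : EuclideanSpace ℝ (Fin N) → ℝ) (x : EuclideanSpace ℝ (Fin N)) {i : ℤ}
    (hi : i = ⌊(x k - a k) / h k⌋) :
    interpDir a h k φ x = φ (setCoord x k (a k + i * h k)) +
      (φ (setCoord x k (a k + (i + 1 : ℤ) * h k)) - φ (setCoord x k (a k + i * h k))) *
        profile (ratios (h k) (fun j : ℤ => φ (setCoord x k (a k + j * h k))) i)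
          ((x k - a k) / h k - i) := by
  subst hi
  exact interp1_eq (hh k) (a k) _ _ (fract_mem _)

/-- Interpolation in one direction of a perturbation of a smooth function. -/
theorem abs_interpDir_sub_le {a h : Fin N → ℝ} (hh : ∀ k, 0 < h k) {Δx : ℝ}
    (hΔ : ∀ k, h k ≤ Δx) {φ : EuclideanSpace ℝ (Fin N) → ℝ}
    (hφ : ContDiff ℝ ((⊤ : ℕ∞) : WithTop ℕ∞) φ) (hm : StrictlyMonotoneBetweenNodes a h φ)
    {p : ℕ} (hp : p ≤ 4) {B : ℝ} (hB : ∀ y, ‖iteratedFDeriv ℝ p φ y‖ ≤ B)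
    {ψ : EuclideanSpace ℝ (Fin N) → ℝ} {E : ℝ} (hψ : ∀ y, |ψ y - φ y| ≤ E) (k : Fin N)
    (x : EuclideanSpace ℝ (Fin N)) :
    |interpDir a h k ψ x - φ x| ≤ 121581 * (E + B * Δx ^ p) := by
  have hB0 : 0 ≤ B := (norm_nonneg _).trans (hB 0)
  obtain ⟨i, hi⟩ : ∃ i, i = ⌊(x k - a k) / h k⌋ := ⟨_, rfl⟩
  rw [interpDir_eq hh k ψ x hi]
  have hline : ∀ t : ℝ, φ (setCoord x k (a k + (i + t) * h k)) =
      φ (setCoord x k (a k + i * h k) + t • EuclideanSpace.single k (h k)) := fun t => by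
    rw [← setCoord_add]
    ring_nf
  have hx : φ x = φ (setCoord x k (a k + i * h k) +
      ((x k - a k) / h k - i) • EuclideanSpace.single k (h k)) := by
    rw [← hline, add_sub_cancel, div_mul_cancel₀ _ (hh k).ne', add_sub_cancel, setCoord_self]
  have hmem : ∀ t ∈ Set.Icc (0 : ℝ) 1,
      a k + (i + t) * h k ∈ Set.Icc (a k + i * h k) (a k + (i + 1) * h k) := by
    intro t ht
    have := hh k
    constructor
    · nlinarith [ht.1]
    · nlinarith [ht.2]
  have hle : ∀ s t : ℝ, s ≤ t → a k + (i + s) * h k ≤ a k + (i + t) * h k := by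
    intro s t hst
    have := hh k
    gcongr
  rw [hx]
  refine abs_interp_sub_le (hh k)
    (f := fun j : ℤ => ψ (setCoord x k (a k + j * h k))) (i := i)
    (u := fun t => φ (setCoord x k (a k + i * h k) + t • EuclideanSpace.single k (h k)))
    (hφ.comp (contDiff_const.add (contDiff_id.smul contDiff_const))) ?_ hp (fun t => ?_)
    (fun j => ?_) (hi ▸ fract_mem ((x k - a k) / h k))
  · refine (hm k i x).imp (fun hmono s hs t ht hst => ?_) (fun hanti s hs t ht hst => ?_)
    · simp only [← hline]
      exact hmono.monotoneOn (hmem s hs) (hmem t ht) (hle s t hst)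
    · simp only [← hline]
      exact hanti.antitoneOn (hmem s hs) (hmem t ht) (hle s t hst)
  · refine (abs_iteratedDeriv_comp_line_le hφ hB _ _ t).trans ?_
    rw [PiLp.norm_single, Real.norm_of_nonneg (hh k).le]
    have := (hh k).le
    gcongr
    exact hΔ k
  · simp only [← hline]
    push_cast
    exact hψ _

/-- One direction turns an error `E` into at most `C(E + ε)` with `C = 121581`; the bound `((2C)^n -
1)ε` is preserved by this recursion. -/
theorem abs_foldr_interpDir_sub_le {a h : Fin N → ℝ} (hh : ∀ k, 0 < h k) {Δx : ℝ}
    (hΔ : ∀ k, h k ≤ Δx) {φ : EuclideanSpace ℝ (Fin N) → ℝ}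
    (hφ : ContDiff ℝ ((⊤ : ℕ∞) : WithTop ℕ∞) φ) (hm : StrictlyMonotoneBetweenNodes a h φ)
    {p : ℕ} (hp : p ≤ 4) {B : ℝ} (hB : ∀ y, ‖iteratedFDeriv ℝ p φ y‖ ≤ B)
    (hε : 0 ≤ B * Δx ^ p) (l : List (Fin N)) (x : EuclideanSpace ℝ (Fin N)) :
    |l.foldr (interpDir a h) φ x - φ x| ≤ (243162 ^ l.length - 1) * (B * Δx ^ p) := by
  induction l generalizing x with
  | nil => simp
  | cons k l ih =>
    refine (abs_interpDir_sub_le hh hΔ hφ hm hp hB ih k x).trans ?_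
    rw [List.length_cons, pow_succ]
    have h1 : (1 : ℝ) ≤ 243162 ^ l.length := one_le_pow₀ (by norm_num)
    nlinarith [mul_nonneg (sub_nonneg.2 h1) hε]

/-! ### Positivity: convex hulls and weights. -/

/-- The points that agree with `x` in the directions outside `l`, and whose coordinates in the
directions in `l` are those of neighbouring nodes. -/
def neighbours (a h : Fin N → ℝ) (l : List (Fin N)) (x : EuclideanSpace ℝ (Fin N)) :
    Set (EuclideanSpace ℝ (Fin N)) :=
  {y | ∀ k, (k ∈ l → (∃ i : ℤ, y k = a k + i * h k) ∧ |x k - y k| < h k) ∧ (k ∉ l → y k = x k)}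

theorem neighbours_setCoord_subset {a h : Fin N → ℝ} {k : Fin N} {l : List (Fin N)} (hk : k ∉ l)
    (x : EuclideanSpace ℝ (Fin N)) (i : ℤ) (hi : |x k - (a k + i * h k)| < h k) :
    neighbours a h l (setCoord x k (a k + i * h k)) ⊆ neighbours a h (k :: l) x := by
  intro y hy m
  obtain ⟨h1, h2⟩ := hy m
  rw [setCoord_apply] at h1 h2
  by_cases hmk : m = k
  · subst hmk
    have h3 := h2 hk
    rw [if_pos rfl] at h3
    refine ⟨fun _ => ⟨⟨i, h3⟩, by rw [h3]; exact hi⟩, fun hm => (hm (by simp)).elim⟩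
  · rw [if_neg hmk] at h1 h2
    simpa [hmk] using ⟨h1, h2⟩

theorem foldr_interpDir_mem_convexHull {a h : Fin N → ℝ} (hh : ∀ k, 0 < h k)
    (φ : EuclideanSpace ℝ (Fin N) → ℝ) {l : List (Fin N)} (hl : l.Nodup)
    (x : EuclideanSpace ℝ (Fin N)) :
    l.foldr (interpDir a h) φ x ∈ convexHull ℝ (φ '' neighbours a h l x) := by
  induction l generalizing x with
  | nil => exact subset_convexHull ℝ _ ⟨x, fun k => by simp, rfl⟩
  | cons k l ih =>
    obtain ⟨hk, hl⟩ := List.nodup_cons.1 hl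
    have hk0 := hh k
    obtain ⟨i, hi⟩ : ∃ i, i = ⌊(x k - a k) / h k⌋ := ⟨_, rfl⟩
    set t := (x k - a k) / h k - i with ht
    have ht0 : 0 ≤ t := by rw [ht, hi]; exact Int.fract_nonneg _
    have ht1 : t < 1 := by rw [ht, hi]; exact Int.fract_lt_one _
    have hxt : x k = a k + (i + t) * h k := by
      rw [ht]; field_simp; ring
    have step : ∀ m : ℤ, |x k - (a k + m * h k)| < h k →
        l.foldr (interpDir a h) φ (setCoord x k (a k + m * h k)) ∈
          convexHull ℝ (φ '' neighbours a h (k :: l) x) := fun m hm =>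
      convexHull_mono (Set.image_mono (neighbours_setCoord_subset hk x m hm)) (ih hl _)
    have h0 := step i (by
      rw [show x k - (a k + i * h k) = t * h k by rw [hxt]; ring, abs_of_nonneg (by positivity)]
      nlinarith)
    rw [List.foldr_cons, interpDir_eq hh k _ x hi]
    -- On a grid hyperplane only the left value enters; the right one is at distance exactly `h k`
    -- and would violate strict locality.
    rcases ht0.eq_or_lt with h2 | h2
    · rw [← ht, ← h2, profile_zero, mul_zero, add_zero]
      exact h0
    · have h1 := step (i + 1) (by
        rw [show x k - (a k + (i + 1 : ℤ) * h k) = -((1 - t) * h k) by rw [hxt]; push_cast; ring,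
          abs_neg, abs_of_nonneg (mul_nonneg (by linarith) hk0.le)]
        nlinarith)
      have hp := profile_mem
        (ratios_mem (h k) (fun j : ℤ => l.foldr (interpDir a h) φ (setCoord x k (a k + j * h k))) i)
        (t := t) ⟨ht0, ht1.le⟩
      convert convex_convexHull ℝ _ h0 h1 (sub_nonneg.2 hp.2) hp.1 (by ring) using 1
      simp only [smul_eq_mul]
      ring

/-- A point of the convex hull of indexed reals is a weighted mean of them. -/
theorem exists_weights_of_mem_convexHull {ι : Type*} {g : ι → ℝ} {J : Set ι} {v : ℝ}
    (hv : v ∈ convexHull ℝ (g '' J)) :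
    ∃ w : ι → ℝ, (∀ j, 0 ≤ w j) ∧ (∀ j, w j ≠ 0 → j ∈ J) ∧ HasSum w 1 ∧
      HasSum (fun j => g j * w j) v := by
  classical
  let C : Set ℝ := {v | ∃ w : ι → ℝ, (∀ j, 0 ≤ w j) ∧ (∀ j, w j ≠ 0 → j ∈ J) ∧ HasSum w 1 ∧
    HasSum (fun j => g j * w j) v}
  have hC : Convex ℝ C := by
    rintro v ⟨w, h1, h2, h3, h4⟩ v' ⟨w', h1', h2', h3', h4'⟩ b c hb hc hbc
    refine ⟨fun j => b * w j + c * w' j, fun j => ?_, fun j hj => ?_, ?_, ?_⟩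
    · exact add_nonneg (mul_nonneg hb (h1 j)) (mul_nonneg hc (h1' j))
    · by_contra hJ
      exact hj (by simp [not_ne_iff.1 (mt (h2 j) hJ), not_ne_iff.1 (mt (h2' j) hJ)])
    · simpa [hbc] using (h3.mul_left b).add (h3'.mul_left c)
    · refine ((h4.mul_left b).add (h4'.mul_left c)).congr_fun fun j => ?_
      ring
  refine convexHull_min ?_ hC hv
  rintro _ ⟨j, hj, rfl⟩
  refine ⟨Pi.single j 1, fun m => ?_, fun m hm => ?_, hasSum_pi_single j 1, ?_⟩
  · by_cases h : m = j
    · subst h; simp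
    · simp [h]
  · by_contra hJ
    exact hm (Pi.single_eq_of_ne (by rintro rfl; exact hJ hj) 1)
  · convert hasSum_single (f := fun m => g m * (Pi.single j 1 : ι → ℝ) m) j
      (fun m hm => by simp [hm]) using 1
    simp

theorem neighbours_subset_image_node {a h : Fin N → ℝ} {l : List (Fin N)} (hl : ∀ k, k ∈ l)
    (x : EuclideanSpace ℝ (Fin N)) :
    neighbours a h l x ⊆ node a h '' {j | ∀ k, |x k - node a h j k| < h k} := by
  intro y hy
  choose j hj using fun k => ((hy k).1 (hl k)).1
  have hyj : node a h j = y := by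
    ext k
    rw [hj k]
    rfl
  refine ⟨j, fun k => ?_, hyj⟩
  rw [hyj]
  exact ((hy k).1 (hl k)).2

/-- Strict locality leaves a single possible weight at a node; total mass one then forces it to be
1. -/
theorem eq_of_abs_node_sub_lt {a h : Fin N → ℝ} {i j : Fin N → ℤ}
    (hij : ∀ k, |node a h j k - node a h i k| < h k) : i = j := by
  funext k
  have h1 := hij k
  have h0 : 0 < h k := (abs_nonneg _).trans_lt h1
  have h2 : node a h j k - node a h i k = ((j k - i k : ℤ) : ℝ) * h k := by
    simp only [node]
    push_cast
    ring
  rw [h2, abs_mul, abs_of_pos h0, mul_lt_iff_lt_one_left h0, ← Int.cast_abs] at h1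
  have h3 : |j k - i k| < 1 := by exact_mod_cast h1
  have := Int.abs_lt_one_iff.1 h3
  omega

theorem exists_weights {a h : Fin N → ℝ} (hh : ∀ k, 0 < h k) (σ : Equiv.Perm (Fin N))
    (φ : EuclideanSpace ℝ (Fin N) → ℝ) (x : EuclideanSpace ℝ (Fin N)) :
    ∃ w : (Fin N → ℤ) → ℝ, (∀ j, 0 ≤ w j) ∧
      (∀ j, w j ≠ 0 → j ∈ {j | ∀ k, |x k - node a h j k| < h k}) ∧ HasSum w 1 ∧
      HasSum (fun j => φ (node a h j) * w j) (interp a h σ φ x) := by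
  have h1 := foldr_interpDir_mem_convexHull (a := a) hh φ (List.nodup_ofFn.2 σ.injective) x
  have h2 := neighbours_subset_image_node (a := a) (h := h)
    (fun k => (List.mem_ofFn' σ k).2 (σ.surjective k)) x
  have h3 := convexHull_mono (𝕜 := ℝ) (Set.image_mono (f := φ) h2) h1
  rw [Set.image_image] at h3
  exact exists_weights_of_mem_convexHull h3

end MonoCubic

theorem mainTheorem8 :
    -- the one-dimensional interpolant is monotone between neighbouring nodes
    (∀ (a h : ℝ) (f : ℤ → ℝ) (i : ℤ), 0 < h →
      (f i ≤ f (i + 1) →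
        MonotoneOn (MonoCubic.interp1 a h f) (Set.Icc (a + i * h) (a + (i + 1) * h))) ∧
      (f (i + 1) ≤ f i →
        AntitoneOn (MonoCubic.interp1 a h f) (Set.Icc (a + i * h) (a + (i + 1) * h)))) ∧
    -- (I2): non-negative weights, for all functions `φ`; they are local and sum up to one
    (∀ (N : ℕ) (a h : Fin N → ℝ) (σ : Equiv.Perm (Fin N)) (φ : EuclideanSpace ℝ (Fin N) → ℝ),
      (∀ k, 0 < h k) →
      ∃ w : (Fin N → ℤ) → EuclideanSpace ℝ (Fin N) → ℝ,
        (∀ j x, 0 ≤ w j x) ∧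
        (∀ i j, w i (MonoCubic.node a h j) = if i = j then 1 else 0) ∧
        (∀ j x, w j x ≠ 0 → ∀ k, |x k - MonoCubic.node a h j k| < h k) ∧
        (∀ x, HasSum (fun j => w j x) 1) ∧
        (∀ x, HasSum (fun j => φ (MonoCubic.node a h j) * w j x)
          (MonoCubic.interp a h σ φ x))) ∧
    -- (I1) with `r = 4`, for functions strictly monotone between grid points
    (∀ N : ℕ, ∃ K : ℝ, 0 ≤ K ∧
      ∀ (a h : Fin N → ℝ) (σ : Equiv.Perm (Fin N)) (Δx : ℝ),
      (∀ k, 0 < h k) → (∀ k, h k ≤ Δx) → 0 < Δx →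
      ∀ φ : EuclideanSpace ℝ (Fin N) → ℝ, ContDiff ℝ ((⊤ : ℕ∞) : WithTop ℕ∞) φ →
      MonoCubic.StrictlyMonotoneBetweenNodes a h φ →
      ∀ p : ℕ, p ≤ 4 → ∀ B : ℝ, (∀ y, ‖iteratedFDeriv ℝ p φ y‖ ≤ B) →
      ∀ x, |MonoCubic.interp a h σ φ x - φ x| ≤ K * B * Δx ^ p) := by
  refine ⟨fun a h f i hh => ⟨MonoCubic.monotoneOn_interp1 hh a, MonoCubic.antitoneOn_interp1 hh a⟩,
    fun N a h σ φ hh => ?_, fun N => ⟨243162 ^ N - 1, ?_, ?_⟩⟩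
  -- The weights are chosen separately at each `x`; no regularity in `x` is required.
  · choose w h1 h2 h3 h4 using fun x => MonoCubic.exists_weights (a := a) hh σ φ x
    have hne : ∀ i j, i ≠ j → w (MonoCubic.node a h j) i = 0 := fun i j hij => by
      by_contra hc
      exact hij (MonoCubic.eq_of_abs_node_sub_lt (h2 _ _ hc))
    refine ⟨fun j x => w x j, fun j x => h1 x j, fun i j => ?_, fun j x => h2 x j, h3, h4⟩
    split_ifs with hij
    · subst hij
      exact (hasSum_single i fun m hm => hne m i hm).unique (h3 _)
    · exact hne i j hij
  · exact sub_nonneg.2 (one_le_pow₀ (by norm_num))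
  · intro a h σ Δx hh hΔ hΔ0 φ hφ hm p hp B hB x
    have hB0 : 0 ≤ B := (norm_nonneg _).trans (hB 0)
    have key := MonoCubic.abs_foldr_interpDir_sub_le hh hΔ hφ hm hp hB
      (mul_nonneg hB0 (pow_nonneg hΔ0.le p)) (List.ofFn σ) x
    rw [List.length_ofFn, ← mul_assoc] at key
    exact key
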